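/- Let $\Sigma$ be a finite alphabet. A Petri net over $\Sigma$ is $N=(P,T,F,\lambda,M_0,M_f)$ with finite disjoint sets $P$ of places and $T$ of transitions, a flow function $F$ giving $F(p,t),F(t,p)\in\mathbb N$ for $p\in P$, $t\in T$, a labelling $\lambda:T\to\Sigma$, and an initial and a final marking $M_0,M_f\in\mathbb N^P$. A transition $t$ can fire in a marking $M$ if $M(p)\ge F(p,t)$ for all $p$, leading to $M'$ with $M'(p)=M(p)-F(p,t)+F(t,p)$; then we write $M\xrightarrow{\lambda(t)}M'$. The coverability language $L(N)$ is the set of words $w\in\Sigma^*$ such that $M_0\xrightarrow{w}M$ for some $M\ge M_f$. The net is deterministic if for every marking $M\in\mathbb N^P$ and every $a\in\Sigma$ there is exactly one $M'$ with $M\xrightarrow{a}M'$, and partially deterministic if there is always at most one such $M'$. Its size is $$|N|=|P||T|\bigl(1+\lceil\log_2(1+\|F\|)\rceil\bigr)+|M_0|+|M_f|,\qquad |M|=|P|\bigl(1+\lceil\log_2(1+\|M\|)\rceil\bigr),$$ where $\|\cdot\|$ is the largest value ($0$ if there are none). The product net $N_1\times N_2$ has places $P_1\sqcup P_2$, one transition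 for every pair $(t_1,t_2)\in T_1\times T_2$ with $\lambda_1(t_1)=\lambda_2(t_2)$ (with this label, acting as $t_i$ on $P_i$), and initial and final markings obtained by putting those of $N_1$ and $N_2$ side by side. An NFA may have several initial states and has no $\varepsilon$-transitions; its size is its number of states. It separates $N_1$ from $N_2$ if its language $R$ satisfies $L(N_1)\subseteq R$ and $R\cap L(N_2)=\emptyset$. An ideal of $\mathbb N^P$ is a non-empty, downward-closed, directed subset. **Proposition.** There is a polynomial $p$ with coefficients in $\mathbb N$ such that the following holds for all finite alphabets $\Sigma$ and all Petri nets $N_1,N_2$ over $\Sigma$ with $L(N_1)\cap L(N_2)=\emptyset$. Put $B=2^{2^{p(|N_1|+|N_2|)}}$. 1. Suppose that $N_2$ is deterministic. Let $Y$ be the set of inclusion-maximal ideals contained in the complement of the set of markings of $N_1\times N_2$ from which a marking that covers the final marking of $N_1\times N_2$ is reachable. Then $Y$ is finite, $|Y|\le B$, and the following NFA with set of states $Y$ separates $N_1$ from $N_2$: a state is initial if it contains the initial marking of $N_1\times N_2$; a state is accepting if it contains a marking whose restriction to $P_1$ covers the final marking of $N_1$; and there is an $a$-transition from $I$ to $J$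 if $J$ contains one of the inclusion-maximal ideals in the downward closure of $\{M' \mid M\xrightarrow{a}M'\text{ in }N_1\times N_2\text{ for some }M\in I\}$. 2. If $N_2$ is only partially deterministic, some NFA with at most $B$ states separates $N_1$ from $N_2$. -/

import Mathlib

/-- A labelled transition system over the alphabet `α` with configurations `S`. -/
structure LTS (α S : Type*) where
  Tr : S → α → S → Prop
  init : Set S
  final : Set S

namespace LTS

variable {α S : Type*}

/-- `W.Path s w s'`: there is a path from `s` to `s'` over the word `w`. -/
def Path (W : LTS α S) : S → List α → S → Prop
  | s, [], s' => s = s'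
  | s, a :: w, s' => ∃ r, W.Tr s a r ∧ Path W r w s'

/-- The words on paths from an initial to a final configuration. -/
def language (W : LTS α S) : Language α :=
  {w | ∃ i ∈ W.init, ∃ f ∈ W.final, W.Path i w f}

/-- The `a`-successors of a set of configurations. -/
def succ (W : LTS α S) (X : Set S) (a : α) : Set S :=
  {s | ∃ x ∈ X, W.Tr x a s}

/-- The configurations from which some final configuration is reachable. -/
def revReach (W : LTS α S) : Set S :=
  {s | ∃ w : List α, ∃ f ∈ W.final, W.Path s w f}

/-- Exactly one initial configuration, and exactly one `a`-successor of every configuration,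
for every letter `a`. -/
def IsDeterministic (W : LTS α S) : Prop :=
  (∃! i, i ∈ W.init) ∧ ∀ s a, ∃! s', W.Tr s a s'

/-- Exactly one initial configuration, and at most one `a`-successor of every configuration,
for every letter `a`. -/
def IsPartialDeterministic (W : LTS α S) : Prop :=
  (∃! i, i ∈ W.init) ∧ ∀ s a s₁ s₂, W.Tr s a s₁ → W.Tr s a s₂ → s₁ = s₂

theorem IsDeterministic.isPartialDeterministic {W : LTS α S} (h : W.IsDeterministic) :
    W.IsPartialDeterministic :=
  ⟨h.1, fun s a _ _ h₁ h₂ => (h.2 s a).unique h₁ h₂⟩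

end LTS

/-- The ideal decomposition of `Z`: the inclusion-maximal ideals (non-empty directed lower sets)
among those contained in `Z`. -/
def idealDecomposition {S : Type*} [Preorder S] (Z : Set S) : Set (Order.Ideal S) :=
  {I | Maximal (fun J : Order.Ideal S => (J : Set S) ⊆ Z) I}

/-- The ideal completion of a quasi-ordered labelled transition system. -/
def LTS.completion {α S : Type*} [Preorder S] (W : LTS α S) : LTS α (Order.Ideal S) where
  Tr I a K := K ∈ idealDecomposition (lowerClosure (W.succ (I : Set S) a) : Set S)
  init := idealDecomposition (lowerClosure W.init : Set S)
  final := {I | ((I : Set S) ∩ W.final).Nonempty}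

/-- A Petri net over the alphabet `α` with places `P` and transitions `T`. The flow function is
given by its two meaningful parts, `pre t p = F(p, t)` and `post t p = F(t, p)`. -/
structure PetriNet (α P T : Type*) where
  pre : T → P → ℕ
  post : T → P → ℕ
  label : T → α
  initial : P → ℕ
  final : P → ℕ

/-- The infinity norm of a marking. -/
def markingNorm {P : Type*} [Fintype P] (M : P → ℕ) : ℕ :=
  Finset.univ.sup M

/-- The size of a marking, with its entries in binary; `Nat.clog 2 x = ⌈log₂ x⌉` for `x ≥ 1`. -/
def markingSize {P : Type*} [Fintype P] (M : P → ℕ) : ℕ :=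
  Fintype.card P * (1 + Nat.clog 2 (1 + markingNorm M))

namespace PetriNet

variable {α P T P₁ T₁ P₂ T₂ : Type*}

/-- `t` is enabled in `M`, and firing it leads to `M'`. The subtraction is exact, since
`pre t ≤ M`. -/
def Fires (N : PetriNet α P T) (t : T) (M M' : P → ℕ) : Prop :=
  (∀ p, N.pre t p ≤ M p) ∧ ∀ p, M' p = M p - N.pre t p + N.post t p

/-- The transition system on markings induced by a Petri net, with acceptance by covering the
final marking. -/
def lts (N : PetriNet α P T) : LTS α (P → ℕ) where
  Tr M a M' := ∃ t, N.Fires t M M' ∧ N.label t = a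
  init := {N.initial}
  final := {M | N.final ≤ M}

/-- The coverability language. -/
def language (N : PetriNet α P T) : Language α :=
  N.lts.language

def IsDeterministic (N : PetriNet α P T) : Prop :=
  N.lts.IsDeterministic

def IsPartialDeterministic (N : PetriNet α P T) : Prop :=
  N.lts.IsPartialDeterministic

/-- The product net: places side by side, and one transition for every pair of transitions that
carry the same label. -/
def prod (N₁ : PetriNet α P₁ T₁) (N₂ : PetriNet α P₂ T₂) :
    PetriNet α (P₁ ⊕ P₂) {t : T₁ × T₂ // N₁.label t.1 = N₂.label t.2} where
  pre t := Sum.elim (N₁.pre t.1.1) (N₂.pre t.1.2)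
  post t := Sum.elim (N₁.post t.1.1) (N₂.post t.1.2)
  label t := N₁.label t.1.1
  initial := Sum.elim N₁.initial N₂.initial
  final := Sum.elim N₁.final N₂.final

/-- The largest value of the flow function. -/
def flowNorm [Fintype P] [Fintype T] (N : PetriNet α P T) : ℕ :=
  Finset.univ.sup fun t : T => max (markingNorm (N.pre t)) (markingNorm (N.post t))

/-- The size of a Petri net, with numbers in binary. -/
def size [Fintype P] [Fintype T] (N : PetriNet α P T) : ℕ :=
  Fintype.card P * Fintype.card T * (1 + Nat.clog 2 (1 + N.flowNorm))
    + markingSize N.initial + markingSize N.final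

/-- The ideals that decompose the complement of the set of markings of the product net from which
its final marking can be covered. -/
def invariantIdeals (N₁ : PetriNet α P₁ T₁) (N₂ : PetriNet α P₂ T₂) :
    Set (Order.Ideal (P₁ ⊕ P₂ → ℕ)) :=
  idealDecomposition ((N₁.prod N₂).lts.revReach)ᶜ

/-- The separating automaton on the ideals of `invariantIdeals`: initial states and transitions
are over-approximations of those of the ideal completion of the product net, and a state is
accepting if the first component of one of its markings covers the final marking of `N₁`. -/
def separatingNFA (N₁ : PetriNet α P₁ T₁) (N₂ : PetriNet α P₂ T₂) :
    NFA α (invariantIdeals N₁ N₂) where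
  step I a := {J | ∃ K, (N₁.prod N₂).lts.completion.Tr I.1 a K ∧ K ≤ J.1}
  start := {J | ∃ K ∈ (N₁.prod N₂).lts.completion.init, K ≤ J.1}
  accept := {J | ∃ M ∈ J.1, N₁.final ≤ fun p => M (Sum.inl p)}

end PetriNet

/-- The language `R` separates `L` from `K`. -/
def Separates {α : Type*} (R L K : Language α) : Prop :=
  (∀ w ∈ L, w ∈ R) ∧ ∀ w ∈ R, w ∉ K

/-! Let `Z` be the set of markings of the product net from which its final marking cannot be
covered. It is downward closed and closed under successors, and it contains the initial marking
because the languages are disjoint. Hence every ideal of initial markings or of successors that the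
completion produces inside `Z` extends to a maximal ideal in `Z`, so the maximal ideals can serve as
states.

Runs of `N₁` are simulated exactly: the current marking is the `P₁`-part of some marking in the
current ideal (`exists_mem_step`). For this, some marking of the ideal must enable the letter in
`N₂`; determinism ensures it, and partial determinism is handled by an accepting sink. Runs of `N₂`
are dominated along every run of the automaton: the `P₂`-part of some marking in the ideal lies
above the current one (`exists_mem_ge_of_mem_step`). If both nets could accept, directedness would
give one marking in the ideal covering both final markings, which contradicts its inclusion in `Z`.

For the number of states, Rackoff's argument bounds the length of shortest covering runs doubly
exponentially. Tokens above a corresponding threshold `C` never matter, so a maximal ideal in `Z` is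
determined by its largest marking with entries at most `C`, which leaves at most `(C + 1) ^ d`
ideals for `d` places. -/

/-- The automaton with its states renamed along an equivalence. -/
def NFA.reindex {α σ τ : Type*} (A : NFA α σ) (e : σ ≃ τ) : NFA α τ where
  step q a := e.symm ⁻¹' A.step (e.symm q) a
  start := e.symm ⁻¹' A.start
  accept := e.symm ⁻¹' A.accept

theorem NFA.evalFrom_reindex {α σ τ : Type*} (A : NFA α σ) (e : σ ≃ τ) (X : Set σ)
    (w : List α) : (A.reindex e).evalFrom (e.symm ⁻¹' X) w = e.symm ⁻¹' A.evalFrom X w := by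
  induction w generalizing X with
  | nil => simp
  | cons a w ih =>
    rw [NFA.evalFrom_cons, NFA.evalFrom_cons, ← ih]
    congr 1
    ext q
    simp only [NFA.mem_stepSet, Set.mem_preimage]
    exact ⟨fun ⟨t, ht, h⟩ => ⟨e.symm t, ht, h⟩,
      fun ⟨t, ht, h⟩ => ⟨e t, by simpa using ht, by simpa [NFA.reindex] using h⟩⟩

theorem NFA.accepts_reindex {α σ τ : Type*} (A : NFA α σ) (e : σ ≃ τ) :
    (A.reindex e).accepts = A.accepts := by
  ext w
  have h : (A.reindex e).evalFrom (A.reindex e).start w = e.symm ⁻¹' A.evalFrom A.start w :=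
    A.evalFrom_reindex e A.start w
  rw [NFA.mem_accepts, NFA.mem_accepts, h]
  exact ⟨fun ⟨q, hq, hw⟩ => ⟨e.symm q, hq, hw⟩,
    fun ⟨q, hq, hw⟩ => ⟨e q, by simpa [NFA.reindex] using hq, by simpa using hw⟩⟩

/-! ### Simulation and invariant arguments for automata -/

namespace LTS

variable {α S σ : Type*}

/-- If every step of `W` can be simulated by `A`, then `A` accepts the language of `W`. -/
theorem mem_accepts_of_simulation (W : LTS α S) (A : NFA α σ) (R : S → σ → Prop)
    (hstart : ∀ i ∈ W.init, ∃ q ∈ A.start, R i q)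
    (hstep : ∀ s q a s', R s q → W.Tr s a s' → ∃ q' ∈ A.step q a, R s' q')
    (haccept : ∀ s q, R s q → s ∈ W.final → q ∈ A.accept) {w : List α}
    (hw : w ∈ W.language) : w ∈ A.accepts := by
  have key : ∀ (w : List α) s f (X : Set σ), (∃ q ∈ X, R s q) → W.Path s w f →
      ∃ q ∈ A.evalFrom X w, R f q := by
    intro w
    induction w with
    | nil =>
      rintro s f X h rfl
      simpa using h
    | cons a w ih =>
      rintro s f X ⟨q, hq, hR⟩ ⟨r, hr, hp⟩
      obtain ⟨q', hq', hR'⟩ := hstep s q a r hR hr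
      rw [NFA.evalFrom_cons]
      exact ih r f _ ⟨q', A.mem_stepSet.2 ⟨q, hq, hq'⟩, hR'⟩ hp
  obtain ⟨i, hi, f, hf, hp⟩ := hw
  obtain ⟨q, hq, hR⟩ := key w i f A.start (hstart i hi) hp
  exact ⟨q, haccept f q hR hf, hq⟩

/-- If a relation holds along all pairs of runs of `A` and `W` over the same word, and never
relates a final configuration to an accepting state, then `A` accepts no word of `W`. -/
theorem notMem_language_of_invariant (W : LTS α S) (A : NFA α σ) (R : S → σ → Prop)
    (hstart : ∀ i ∈ W.init, ∀ q ∈ A.start, R i q)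
    (hstep : ∀ s q a s' q', R s q → W.Tr s a s' → q' ∈ A.step q a → R s' q')
    (haccept : ∀ s q, R s q → s ∈ W.final → q ∉ A.accept) {w : List α}
    (hw : w ∈ A.accepts) : w ∉ W.language := by
  have key : ∀ (w : List α) s f (X : Set σ), (∀ q ∈ X, R s q) → W.Path s w f →
      ∀ q ∈ A.evalFrom X w, R f q := by
    intro w
    induction w with
    | nil =>
      rintro s f X h rfl
      simpa using h
    | cons a w ih =>
      rintro s f X h ⟨r, hr, hp⟩
      rw [NFA.evalFrom_cons]
      refine ih r f _ (fun q' hq' => ?_) hp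
      obtain ⟨q, hq, hq'⟩ := A.mem_stepSet.1 hq'
      exact hstep s q a r q' (h q hq) hr hq'
  rintro ⟨i, hi, f, hf, hp⟩
  obtain ⟨q, hacc, hq⟩ := hw
  exact haccept f q (key w i f A.start (hstart i hi) hp q hq) hf hacc

end LTS

/-! ### Maximal ideals and their number -/

/-- Every ideal contained in `Z` is contained in a maximal one. -/
theorem exists_mem_idealDecomposition_ge {S : Type*} [Preorder S] {Z : Set S}
    (I : Order.Ideal S) (hI : (I : Set S) ⊆ Z) : ∃ J ∈ idealDecomposition Z, I ≤ J := by
  obtain ⟨J, hIJ, hJ⟩ := zorn_le_nonempty₀ {J : Order.Ideal S | (J : Set S) ⊆ Z}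
    (fun c hcZ hc K hK => by
      refine ⟨⟨⟨⋃ J ∈ c, (J : Set S), ?_⟩, ?_, ?_⟩, ?_, ?_⟩
      · intro x y hyx hx
        simp only [Set.mem_iUnion] at hx ⊢
        obtain ⟨J, hJ, hx⟩ := hx
        exact ⟨J, hJ, J.lower hyx hx⟩
      · obtain ⟨x, hx⟩ := K.nonempty
        exact ⟨x, Set.mem_biUnion hK hx⟩
      · intro x hx y hy
        simp only [Set.mem_iUnion, exists_prop] at hx hy ⊢
        obtain ⟨J, hJ, hx⟩ := hx
        obtain ⟨L, hL, hy⟩ := hy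
        rcases hc.total hJ hL with h | h
        · obtain ⟨z, hz, h₁, h₂⟩ := L.directed x (h hx) y hy
          exact ⟨z, ⟨L, hL, hz⟩, h₁, h₂⟩
        · obtain ⟨z, hz, h₁, h₂⟩ := J.directed x hx y (h hy)
          exact ⟨z, ⟨J, hJ, hz⟩, h₁, h₂⟩
      · exact Set.iUnion₂_subset hcZ
      · exact fun J hJ x hx => Set.mem_biUnion hJ hx) I hI
  exact ⟨J, hJ, hIJ⟩

theorem exists_mem_idealDecomposition_of_mem {S : Type*} [Preorder S] {Z : Set S}
    (hZ : IsLowerSet Z) {x : S} (hx : x ∈ Z) : ∃ J ∈ idealDecomposition Z, x ∈ J := by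
  obtain ⟨J, hJ, h⟩ := exists_mem_idealDecomposition_ge (Order.Ideal.principal x)
    (fun y hy => hZ (Order.Ideal.mem_principal.1 hy) hx)
  exact ⟨J, hJ, h (Order.Ideal.mem_principal.2 le_rfl)⟩

/-- A maximal ideal in the complement of a set that is closed under truncation at `c` is
determined by its largest marking below `c`. -/
theorem exists_forall_mem_iff_inf_le {P : Type*} [Finite P] {U : Set (P → ℕ)} {c : P → ℕ}
    (hc : ∀ M ∈ U, M ⊓ c ∈ U) {I : Order.Ideal (P → ℕ)} (hI : I ∈ idealDecomposition Uᶜ) :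
    ∃ m ≤ c, ∀ M, M ∈ I ↔ M ⊓ c ≤ m := by
  classical
  cases nonempty_fintype P
  -- The ideal of all markings whose truncation lies in `I`. It contains `I` and still avoids `U`,
  -- so maximality forces `J = I`.
  let J : Order.Ideal (P → ℕ) :=
    { carrier := {M | M ⊓ c ∈ I}
      lower' := fun x y hyx hx => I.lower (inf_le_inf_right c hyx) hx
      nonempty' := by
        obtain ⟨x, hx⟩ := I.nonempty
        exact ⟨x, I.lower inf_le_left hx⟩
      directed' := fun x hx y hy => by
        refine ⟨x ⊔ y, ?_, le_sup_left, le_sup_right⟩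
        change (x ⊔ y) ⊓ c ∈ I
        rw [inf_sup_right]
        exact Order.Ideal.sup_mem hx hy }
  have hIJ : I ≤ J := fun x hx => I.lower inf_le_left hx
  have hJI : J ≤ I := hI.2 (fun M (hM : M ⊓ c ∈ I) hMU => hI.1 hM (hc M hMU)) hIJ
  have hfin : ((I : Set (P → ℕ)) ∩ Set.Iic c).Finite :=
    (Set.finite_Iic c).subset Set.inter_subset_right
  obtain ⟨x, hx⟩ := I.nonempty
  -- The finite set `I ∩ Iic c` is closed under joins, so a maximal element is the greatest one.
  obtain ⟨m, hm⟩ := hfin.exists_maximal ⟨x ⊓ c, I.lower inf_le_left hx, inf_le_right (a := x)⟩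
  refine ⟨m, hm.1.2, fun M => ⟨fun hM => ?_, fun hM => hJI (I.lower hM hm.1.1)⟩⟩
  have h : m ⊔ M ⊓ c ∈ (I : Set (P → ℕ)) ∩ Set.Iic c :=
    ⟨Order.Ideal.sup_mem hm.1.1 (hIJ hM), sup_le (a := m) hm.1.2 inf_le_right⟩
  exact le_sup_right.trans (hm.2 h le_sup_left)

theorem finite_idealDecomposition_compl {P : Type*} [Fintype P] {U : Set (P → ℕ)} {C : ℕ}
    (hC : ∀ M ∈ U, (M ⊓ fun _ => C) ∈ U) :
    (idealDecomposition Uᶜ).Finite ∧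
      (idealDecomposition Uᶜ).ncard ≤ (C + 1) ^ Fintype.card P := by
  classical
  choose m hmC hm using fun I : idealDecomposition Uᶜ => exists_forall_mem_iff_inf_le hC I.2
  let g : idealDecomposition Uᶜ → P → Fin (C + 1) :=
    fun I p => ⟨m I p, Nat.lt_succ_of_le (hmC I p)⟩
  have hg : Function.Injective g := by
    intro I J h
    have hIJ : m I = m J := funext fun p => congrArg Fin.val (congrFun h p)
    refine Subtype.ext (SetLike.ext fun M => ?_)
    rw [hm I, hm J, hIJ]
  refine ⟨Set.finite_coe_iff.1 (Finite.of_injective g hg), ?_⟩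
  have := Nat.card_le_card_of_injective g hg
  rw [Nat.card_coe_set_eq, Nat.card_eq_fintype_card] at this
  simpa using this

/-! ### Bounded coverability and Rackoff's bound -/

namespace PetriNet

variable {α P T P₁ T₁ P₂ T₂ : Type*}

/-- The markings from which at most `n` firings lead to a marking that covers the final one,
if only the places in `Q` are taken into account. -/
def coverableWithin (N : PetriNet α P T) (Q : Finset P) : ℕ → Set (P → ℕ)
  | 0 => {M | ∀ p ∈ Q, N.final p ≤ M p}
  -- Outside `Q` the subtraction may truncate; this is harmless since those entries are never
  -- inspected.
  | n + 1 => {M | M ∈ N.coverableWithin Q n ∨ ∃ t, (∀ p ∈ Q, N.pre t p ≤ M p) ∧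
      (fun p => M p - N.pre t p + N.post t p) ∈ N.coverableWithin Q n}

theorem coverableWithin_mono (N : PetriNet α P T) (Q : Finset P) :
    Monotone (N.coverableWithin Q) :=
  monotone_nat_of_le_succ fun _ _ h => Or.inl h

theorem mem_coverableWithin_of_le (N : PetriNet α P T) {Q : Finset P} {n : ℕ} {M M' : P → ℕ}
    (hM : M ∈ N.coverableWithin Q n) (h : ∀ p ∈ Q, M p ≤ M' p) :
    M' ∈ N.coverableWithin Q n := by
  induction n generalizing M M' with
  | zero => exact fun p hp => (hM p hp).trans (h p hp)
  | succ n ih =>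
    rcases hM with hM | ⟨t, ht, hM⟩
    · exact Or.inl (ih hM h)
    · exact Or.inr ⟨t, fun p hp => (ht p hp).trans (h p hp), ih hM fun p hp => by
        have := h p hp
        omega⟩

theorem coverableWithin_anti (N : PetriNet α P T) {Q Q' : Finset P} (h : Q' ⊆ Q) (n : ℕ) :
    N.coverableWithin Q n ⊆ N.coverableWithin Q' n := by
  induction n with
  | zero => exact fun M hM p hp => hM p (h hp)
  | succ n ih =>
    rintro M (hM | ⟨t, ht, hM⟩)
    · exact Or.inl (ih hM)
    · exact Or.inr ⟨t, fun p hp => ht p (h hp), ih hM⟩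

section Bounded

variable {N : PetriNet α P T} {R : ℕ}

/-- A place with sufficiently many tokens can be ignored. -/
theorem mem_coverableWithin_of_erase [DecidableEq P] (hpre : ∀ t p, N.pre t p ≤ R)
    (hfinal : ∀ p, N.final p ≤ R) {Q : Finset P} {q : P} {n : ℕ} {M : P → ℕ}
    (hM : M ∈ N.coverableWithin (Q.erase q) n) (hq : R * (1 + n) ≤ M q) :
    M ∈ N.coverableWithin Q n := by
  induction n generalizing M with
  | zero =>
    intro p hp
    rcases eq_or_ne p q with rfl | hpq
    · have := hfinal p
      omega
    · exact hM p (Finset.mem_erase.2 ⟨hpq, hp⟩)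
  | succ n ih =>
    -- Each firing consumes at most `R` tokens from `q`; the last `R` tokens serve the final
    -- marking.
    have hR : R * (1 + (n + 1)) = R * (1 + n) + R := by ring
    rcases hM with hM | ⟨t, ht, hM⟩
    · exact Or.inl (ih hM (by omega))
    · have h := hpre t q
      refine Or.inr ⟨t, fun p hp => ?_, ih hM (by omega)⟩
      rcases eq_or_ne p q with rfl | hpq
      · have : 0 ≤ R * (1 + n) := Nat.zero_le _
        omega
      · exact ht p (Finset.mem_erase.2 ⟨hpq, hp⟩)

/-- Tokens that cannot be consumed within `n` steps are irrelevant. -/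
theorem inf_mem_coverableWithin (hpre : ∀ t p, N.pre t p ≤ R) (hfinal : ∀ p, N.final p ≤ R)
    {Q : Finset P} {n : ℕ} {M : P → ℕ} (hM : M ∈ N.coverableWithin Q n) :
    (M ⊓ fun _ => R * (1 + n)) ∈ N.coverableWithin Q n := by
  induction n generalizing M with
  | zero =>
    intro p hp
    have := hM p hp
    have := hfinal p
    simp only [Pi.inf_apply, le_inf_iff]
    omega
  | succ n ih =>
    have hR : R * (1 + (n + 1)) = R * (1 + n) + R := by ring
    rcases hM with hM | ⟨t, ht, hM⟩
    · refine Or.inl (N.mem_coverableWithin_of_le (ih hM) fun p _ => ?_)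
      simp only [Pi.inf_apply]
      omega
    · refine Or.inr ⟨t, fun p hp => ?_, N.mem_coverableWithin_of_le (ih hM) fun p hp => ?_⟩
      all_goals
        have := ht p hp
        have := hpre t p
        simp only [Pi.inf_apply]
        omega

/-- Rackoff's bound on the length of covering runs, for `k` places and numbers up to `R`. -/
def rackoffBound (R : ℕ) : ℕ → ℕ
  | 0 => 0
  | k + 1 => rackoffBound R k + (R * (1 + rackoffBound R k)) ^ (k + 1)

/-- Induction on the number of places. While all counted places stay below `B`, a shortest covering
run cannot pass through two markings that agree on `Q`, so this phase has at most `B ^ (k + 1)`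
steps. Once some place reaches `B`, it has enough tokens to be ignored, and `b` further steps
suffice by induction. -/
theorem coverableWithin_subset_rackoffBound (hpre : ∀ t p, N.pre t p ≤ R)
    (hfinal : ∀ p, N.final p ≤ R) (Q : Finset P) (n : ℕ) :
    N.coverableWithin Q n ⊆ N.coverableWithin Q (rackoffBound R Q.card) := by
  classical
  obtain ⟨k, hk⟩ : ∃ k, Q.card = k := ⟨_, rfl⟩
  rw [hk]
  induction k generalizing Q n with
  | zero =>
    obtain rfl := Finset.card_eq_zero.1 hk
    exact fun M _ p hp => absurd hp (Finset.notMem_empty p)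
  | succ k ih =>
    set b := rackoffBound R k with hb
    set B := R * (1 + b) with hB
    -- `layer r` holds the markings whose least number of steps is exactly `r + 1`.
    let layer : ℕ → Set (P → ℕ) := fun r => N.coverableWithin Q (r + 1) \ N.coverableWithin Q r
    have hlayer : ∀ r, (layer (r + 1)).Nonempty → (layer r).Nonempty := by
      rintro r ⟨M, hM | ⟨t, ht, hM⟩, hM'⟩
      · exact absurd hM hM'
      · exact ⟨_, hM, fun h => hM' (Or.inr ⟨t, ht, h⟩)⟩
    have hbound : ∀ r ≥ b, ∀ M ∈ layer r, ∀ p ∈ Q, M p < B := by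
      intro r hr M hM p hp
      by_contra! h
      refine hM.2 (N.coverableWithin_mono Q hr (mem_coverableWithin_of_erase hpre hfinal ?_ h))
      exact ih (Q.erase p) (r + 1) (by rw [Finset.card_erase_of_mem hp, hk]; rfl)
        (N.coverableWithin_anti (Finset.erase_subset p Q) _ hM.1)
    change N.coverableWithin Q n ⊆ N.coverableWithin Q (b + B ^ (k + 1))
    intro M hM
    by_contra hM'
    have hex : ∃ n, M ∈ N.coverableWithin Q n := ⟨n, hM⟩
    have hlt : b + B ^ (k + 1) < Nat.find hex := by
      by_contra! h
      exact hM' (N.coverableWithin_mono Q h (Nat.find_spec hex))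
    obtain ⟨r, hr⟩ : ∃ r, Nat.find hex = r + 1 := ⟨Nat.find hex - 1, by omega⟩
    have htop : (layer r).Nonempty :=
      ⟨M, hr ▸ Nat.find_spec hex, Nat.find_min hex (by omega)⟩
    have hall : ∀ j ≤ r, (layer j).Nonempty := fun j hj =>
      Nat.decreasingInduction (motive := fun j _ => (layer j).Nonempty)
        (fun j _ h => hlayer j h) htop hj
    -- One marking from each of `B ^ (k + 1) + 1` consecutive layers: two must agree on `Q`,
    -- although their least numbers of steps differ.
    choose x hx using fun i : Fin (B ^ (k + 1) + 1) => hall (b + i) (by have := i.2; omega)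
    let g : Fin (B ^ (k + 1) + 1) → Q → Fin B :=
      fun i p => ⟨x i p, hbound (b + i) (Nat.le_add_right _ _) (x i) (hx i) p p.2⟩
    obtain ⟨i, j, hij, hg⟩ := Fintype.exists_ne_map_eq_of_card_lt g (by simp [hk])
    have hg' : ∀ p ∈ Q, x i p = x j p := fun p hp =>
      congrArg Fin.val (congrFun hg ⟨p, hp⟩)
    have hne : (i : ℕ) ≠ j := fun h => hij (Fin.ext h)
    rcases Nat.lt_or_gt_of_ne hne with h | h
    · exact (hx j).2 (N.mem_coverableWithin_of_le
        (N.coverableWithin_mono Q (by omega) (hx i).1) fun p hp => (hg' p hp).le)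
    · exact (hx i).2 (N.mem_coverableWithin_of_le
        (N.coverableWithin_mono Q (by omega) (hx j).1) fun p hp => (hg' p hp).ge)

end Bounded

/-! ### Backward reachability and steps of the ideal completion -/

theorem fires_iff {N : PetriNet α P T} {t : T} {M M' : P → ℕ} :
    N.Fires t M M' ↔ (∀ p, N.pre t p ≤ M p) ∧ M' = fun p => M p - N.pre t p + N.post t p :=
  and_congr_right fun _ => funext_iff.symm

theorem mem_revReach_iff [Fintype P] (N : PetriNet α P T) (M : P → ℕ) :
    M ∈ N.lts.revReach ↔ ∃ n, M ∈ N.coverableWithin Finset.univ n := by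
  constructor
  · rintro ⟨w, f, hf, hp⟩
    refine ⟨w.length, ?_⟩
    induction w generalizing M with
    | nil =>
      obtain rfl : M = f := hp
      exact fun p _ => hf p
    | cons a w ih =>
      obtain ⟨M', ⟨t, ht, -⟩, hp⟩ := hp
      obtain ⟨hpre, rfl⟩ := fires_iff.1 ht
      exact Or.inr ⟨t, fun p _ => hpre p, ih _ hp⟩
  · rintro ⟨n, hM⟩
    induction n generalizing M with
    | zero => exact ⟨[], M, fun p => hM p (Finset.mem_univ p), rfl⟩
    | succ n ih =>
      rcases hM with hM | ⟨t, ht, hM⟩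
      · exact ih M hM
      · obtain ⟨w, f, hf, hp⟩ := ih _ hM
        exact ⟨N.label t :: w, f, hf, _, ⟨t, fires_iff.2 ⟨fun p => ht p (Finset.mem_univ p), rfl⟩,
          rfl⟩, hp⟩

theorem isUpperSet_revReach [Fintype P] (N : PetriNet α P T) : IsUpperSet N.lts.revReach := by
  intro M M' h hM
  rw [mem_revReach_iff] at hM ⊢
  obtain ⟨n, hn⟩ := hM
  exact ⟨n, N.mem_coverableWithin_of_le hn fun p _ => h p⟩

theorem inf_mem_revReach [Fintype P] {N : PetriNet α P T} {R : ℕ}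
    (hpre : ∀ t p, N.pre t p ≤ R) (hfinal : ∀ p, N.final p ≤ R) {M : P → ℕ}
    (hM : M ∈ N.lts.revReach) :
    (M ⊓ fun _ => R * (1 + rackoffBound R (Fintype.card P))) ∈ N.lts.revReach := by
  rw [mem_revReach_iff] at hM ⊢
  obtain ⟨n, hn⟩ := hM
  exact ⟨_, inf_mem_coverableWithin hpre hfinal
    (coverableWithin_subset_rackoffBound hpre hfinal Finset.univ n hn)⟩

theorem mem_revReach_of_tr {N : PetriNet α P T} {M M' : P → ℕ} {a : α} (h : N.lts.Tr M a M')
    (hM' : M' ∈ N.lts.revReach) : M ∈ N.lts.revReach := by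
  obtain ⟨w, f, hf, hp⟩ := hM'
  exact ⟨a :: w, f, hf, M', h, hp⟩

/-- Every `a`-successor of an ideal in the ideal completion arises from a single transition. -/
theorem exists_transition_of_completion_tr [Finite T] {N : PetriNet α P T}
    {I K : Order.Ideal (P → ℕ)} {a : α} (h : N.lts.completion.Tr I a K) :
    ∃ t, N.label t = a ∧ (∃ M ∈ I, ∀ p, N.pre t p ≤ M p) ∧
      ∀ M ∈ I, (∀ p, N.pre t p ≤ M p) → (fun p => M p - N.pre t p + N.post t p) ∈ K := by
  have hK : ∀ z ∈ K, ∃ t, N.label t = a ∧ ∃ M ∈ I, (∀ p, N.pre t p ≤ M p) ∧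
      z ≤ fun p => M p - N.pre t p + N.post t p := by
    intro z hz
    obtain ⟨M', ⟨M, hM, t, ht, hta⟩, hzM⟩ := h.1 hz
    obtain ⟨hpre, rfl⟩ := fires_iff.1 ht
    exact ⟨t, hta, M, hM, hpre, hzM⟩
  -- If each transition failed at some element of `K`, the join of these finitely many elements
  -- would still lie in `K` and defeat them all.
  obtain ⟨t, ht⟩ : ∃ t, N.label t = a ∧ ∀ z ∈ K, ∃ M ∈ I, (∀ p, N.pre t p ≤ M p) ∧
      z ≤ fun p => M p - N.pre t p + N.post t p := by
    by_contra! hcon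
    have hz : ∀ t, ∃ z ∈ K, N.label t = a → ∀ M ∈ I, (∀ p, N.pre t p ≤ M p) →
        ¬ z ≤ fun p => M p - N.pre t p + N.post t p := by
      intro t
      by_cases hta : N.label t = a
      · obtain ⟨z, hz, h⟩ := hcon t hta
        exact ⟨z, hz, fun _ => h⟩
      · obtain ⟨z, hz⟩ := K.nonempty
        exact ⟨z, hz, fun h => absurd h hta⟩
    choose z hzK hz using hz
    cases nonempty_fintype T
    obtain ⟨t, hta, M, hM, hpre, hle⟩ := hK (Finset.univ.sup z)
      (Order.Ideal.finsetSup_mem_iff K |>.2 fun t _ => hzK t)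
    exact hz t hta M hM hpre ((Finset.le_sup (Finset.mem_univ t)).trans hle)
  obtain ⟨hta, ht⟩ := ht
  have hne : ∃ M ∈ I, ∀ p, N.pre t p ≤ M p := by
    obtain ⟨z, hz⟩ := K.nonempty
    obtain ⟨M, hM, hpre, -⟩ := ht z hz
    exact ⟨M, hM, hpre⟩
  -- The ideal generated by firing `t` from `I`. It contains `K` and lies in the downward closure of
  -- the successors, so maximality of `K` gives `L ≤ K`.
  let L : Order.Ideal (P → ℕ) :=
    { carrier := {z | ∃ M ∈ I, (∀ p, N.pre t p ≤ M p) ∧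
        z ≤ fun p => M p - N.pre t p + N.post t p}
      lower' := by
        rintro x y hyx ⟨M, hM, hpre, hx⟩
        exact ⟨M, hM, hpre, hyx.trans hx⟩
      nonempty' := by
        obtain ⟨M, hM, hpre⟩ := hne
        exact ⟨_, M, hM, hpre, le_rfl⟩
      directed' := by
        rintro x ⟨M, hM, hpre, hx⟩ y ⟨M', hM', hpre', hy⟩
        refine ⟨_, ⟨M ⊔ M', Order.Ideal.sup_mem hM hM',
          fun p => (hpre p).trans (le_sup_left (a := M p)), le_rfl⟩, hx.trans ?_, hy.trans ?_⟩
        · exact fun p => Nat.add_le_add_right (Nat.sub_le_sub_right (le_sup_left (a := M p)) _) _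
        · exact fun p => Nat.add_le_add_right (Nat.sub_le_sub_right (le_sup_right (a := M p)) _) _ }
  have hLK : L ≤ K := by
    refine h.2 ?_ fun z hz => ht z hz
    rintro z ⟨M, hM, hpre, hz⟩
    exact ⟨_, ⟨M, hM, t, fires_iff.2 ⟨hpre, rfl⟩, hta⟩, hz⟩
  exact ⟨t, hta, hne, fun M hM hpre => hLK ⟨M, hM, hpre, le_rfl⟩⟩

/-! ### The separating automaton on the product net -/

section Product

variable {N₁ : PetriNet α P₁ T₁} {N₂ : PetriNet α P₂ T₂}

theorem path_prod {w : List α} {M M' : P₁ ⊕ P₂ → ℕ} (h : (N₁.prod N₂).lts.Path M w M') :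
    N₁.lts.Path (fun p => M (Sum.inl p)) w (fun p => M' (Sum.inl p)) ∧
      N₂.lts.Path (fun p => M (Sum.inr p)) w (fun p => M' (Sum.inr p)) := by
  induction w generalizing M with
  | nil =>
    obtain rfl : M = M' := h
    exact ⟨rfl, rfl⟩
  | cons a w ih =>
    obtain ⟨M'', ⟨t, ht, hta⟩, hp⟩ := h
    exact ⟨⟨_, ⟨t.1.1, ⟨fun p => ht.1 (Sum.inl p), fun p => ht.2 (Sum.inl p)⟩, hta⟩, (ih hp).1⟩,
      ⟨_, ⟨t.1.2, ⟨fun p => ht.1 (Sum.inr p), fun p => ht.2 (Sum.inr p)⟩, t.2.symm.trans hta⟩,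
        (ih hp).2⟩⟩

theorem initial_notMem_revReach (h : ∀ w, w ∈ N₁.language → w ∉ N₂.language) :
    (N₁.prod N₂).initial ∉ (N₁.prod N₂).lts.revReach := by
  rintro ⟨w, f, hf, hp⟩
  obtain ⟨h₁, h₂⟩ := path_prod hp
  exact h w ⟨_, rfl, _, fun p => hf (Sum.inl p), h₁⟩ ⟨_, rfl, _, fun p => hf (Sum.inr p), h₂⟩

theorem exists_mem_start [Fintype P₁] [Fintype P₂]
    (h : ∀ w, w ∈ N₁.language → w ∉ N₂.language) :
    ∃ J ∈ (separatingNFA N₁ N₂).start, (N₁.prod N₂).initial ∈ J.1 := by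
  obtain ⟨K, hK, hmem⟩ := exists_mem_idealDecomposition_of_mem
    (lowerClosure (N₁.prod N₂).lts.init).lower
    (subset_lowerClosure (Set.mem_singleton (N₁.prod N₂).initial))
  obtain ⟨J, hJ, hKJ⟩ := exists_mem_idealDecomposition_ge
    (Z := (N₁.prod N₂).lts.revReachᶜ) K (fun M hM hM' => by
      obtain ⟨_, rfl, hle⟩ := hK.1 hM
      exact initial_notMem_revReach h (isUpperSet_revReach _ hle hM'))
  exact ⟨⟨J, hJ⟩, ⟨K, hK, hKJ⟩, hKJ hmem⟩

/-- The downward closure of the single initial marking is a principal ideal, hence its only maximal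
ideal. -/
theorem initial_mem_of_mem_start {J : invariantIdeals N₁ N₂}
    (hJ : J ∈ (separatingNFA N₁ N₂).start) : (N₁.prod N₂).initial ∈ J.1 := by
  obtain ⟨K, hK, hKJ⟩ := hJ
  refine hKJ (hK.2 (y := Order.Ideal.principal (N₁.prod N₂).initial) ?_ ?_
    (Order.Ideal.mem_principal.2 le_rfl))
  · exact fun M hM => ⟨_, rfl, Order.Ideal.mem_principal.1 hM⟩
  · intro M hM
    obtain ⟨_, rfl, hle⟩ := hK.1 hM
    exact Order.Ideal.mem_principal.2 hle

/-- A step of the first net lifts to the separating automaton if some marking of the ideal enables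
the letter in the second net. -/
theorem exists_mem_step [Fintype P₁] [Fintype P₂] {I : invariantIdeals N₁ N₂} {a : α}
    {M M' : P₁ → ℕ} (hM : ∃ X ∈ I.1, M = fun p => X (Sum.inl p)) (htr : N₁.lts.Tr M a M')
    (hen : ∃ X ∈ I.1, ∃ Y, N₂.lts.Tr (fun p => X (Sum.inr p)) a Y) :
    ∃ J ∈ (separatingNFA N₁ N₂).step I a, ∃ X ∈ J.1, M' = fun p => X (Sum.inl p) := by
  obtain ⟨X, hX, rfl⟩ := hM
  obtain ⟨X', hX', Y, t₂, ht₂, rfl⟩ := hen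
  obtain ⟨t₁, ht₁, hlabel⟩ := htr
  let t : {t : T₁ × T₂ // N₁.label t.1 = N₂.label t.2} := ⟨(t₁, t₂), hlabel⟩
  obtain ⟨hpre₁, rfl⟩ := fires_iff.1 ht₁
  -- Keeping `X` on `P₁` makes the simulation exact; the join on `P₂` enables `t₂`. Downward closure
  -- keeps this mixture in `I`.
  let V : P₁ ⊕ P₂ → ℕ := Sum.elim (fun p => X (Sum.inl p)) fun p => (X ⊔ X') (Sum.inr p)
  have hV : V ∈ I.1 := by
    refine I.1.lower (a := X ⊔ X') ?_ (Order.Ideal.sup_mem hX hX')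
    rintro (p | p)
    · exact le_sup_left (a := X (Sum.inl p))
    · exact le_rfl
  have htr : (N₁.prod N₂).lts.Tr V (N₂.label t₂)
      (fun p => V p - (N₁.prod N₂).pre t p + (N₁.prod N₂).post t p) := by
    refine ⟨t, fires_iff.2 ⟨?_, rfl⟩, hlabel⟩
    rintro (p | p)
    · exact hpre₁ p
    · exact (ht₂.1 p).trans (le_sup_right (a := X (Sum.inr p)))
  obtain ⟨K, hK, hmem⟩ := exists_mem_idealDecomposition_of_mem
    (lowerClosure ((N₁.prod N₂).lts.succ I.1 (N₂.label t₂))).lower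
    (subset_lowerClosure ⟨V, hV, htr⟩)
  obtain ⟨J, hJ, hKJ⟩ := exists_mem_idealDecomposition_ge
    (Z := (N₁.prod N₂).lts.revReachᶜ) K (fun M hM hM' => by
      obtain ⟨M'', ⟨M₀, hM₀, htr⟩, hle⟩ := hK.1 hM
      exact I.2.1 hM₀ (mem_revReach_of_tr htr (isUpperSet_revReach _ hle hM')))
  exact ⟨⟨J, hJ⟩, ⟨K, hK, hKJ⟩, _, hKJ hmem, rfl⟩

/-- The ideals on a run of the separating automaton dominate the run of the second net. -/
theorem exists_mem_ge_of_mem_step [Finite T₁] [Finite T₂] (hdet : N₂.IsPartialDeterministic)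
    {I J : invariantIdeals N₁ N₂} {a : α} {M M' : P₂ → ℕ}
    (hM : ∃ X ∈ I.1, M ≤ fun p => X (Sum.inr p)) (htr : N₂.lts.Tr M a M')
    (hJ : J ∈ (separatingNFA N₁ N₂).step I a) : ∃ X ∈ J.1, M' ≤ fun p => X (Sum.inr p) := by
  obtain ⟨X, hX, hMX⟩ := hM
  obtain ⟨K, hK, hKJ⟩ := hJ
  obtain ⟨t, rfl, ⟨X', hX', hpre⟩, ht⟩ := exists_transition_of_completion_tr hK
  obtain ⟨t₂, hfire, hlabel⟩ := htr
  obtain ⟨hpre₂, rfl⟩ := fires_iff.1 hfire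
  have hle : X' ≤ X ⊔ X' := le_sup_right
  have hle' : M ≤ fun p => (X ⊔ X') (Sum.inr p) :=
    hMX.trans fun p => le_sup_left (a := X (Sum.inr p))
  refine ⟨_, hKJ (ht (X ⊔ X') (Order.Ideal.sup_mem hX hX') fun p => (hpre p).trans (hle p)), ?_⟩
  -- At the join both `t.1.2` and `t₂` are enabled with the same label, so by partial determinism
  -- they lead to the same marking, even if they are different transitions.
  have huniq := hdet.2 (fun p => (X ⊔ X') (Sum.inr p)) ((N₁.prod N₂).label t)
    (fun p => (X ⊔ X') (Sum.inr p) - N₂.pre t.1.2 p + N₂.post t.1.2 p)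
    (fun p => (X ⊔ X') (Sum.inr p) - N₂.pre t₂ p + N₂.post t₂ p)
    ⟨t.1.2, fires_iff.2 ⟨fun p => (hpre (Sum.inr p)).trans (hle (Sum.inr p)), rfl⟩, t.2.symm⟩
    ⟨t₂, fires_iff.2 ⟨fun p => (hpre₂ p).trans (hle' p), rfl⟩, hlabel⟩
  change _ ≤ fun p => (X ⊔ X') (Sum.inr p) - N₂.pre t.1.2 p + N₂.post t.1.2 p
  rw [huniq]
  exact fun p => Nat.add_le_add_right (Nat.sub_le_sub_right (hle' p) _) _

/-- The markings covering the two final markings may differ, but their join lies in the ideal and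
covers the final marking of the product. -/
theorem notMem_accept_of_final_le {I : invariantIdeals N₁ N₂} {M : P₂ → ℕ}
    (hM : ∃ X ∈ I.1, M ≤ fun p => X (Sum.inr p)) (hfinal : N₂.final ≤ M) :
    I ∉ (separatingNFA N₁ N₂).accept := by
  rintro ⟨X', hX', hle'⟩
  obtain ⟨X, hX, hle⟩ := hM
  refine I.2.1 (Order.Ideal.sup_mem hX hX') ⟨[], _, ?_, rfl⟩
  rintro (p | p)
  · exact (hle' p).trans (le_sup_right (a := X (Sum.inl p)))
  · exact ((hfinal p).trans (hle p)).trans (le_sup_left (a := X (Sum.inr p)))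

theorem separates_separatingNFA [Fintype P₁] [Fintype P₂] [Finite T₁] [Finite T₂]
    (h : ∀ w, w ∈ N₁.language → w ∉ N₂.language) (hdet : N₂.IsDeterministic) :
    Separates (separatingNFA N₁ N₂).accepts N₁.language N₂.language := by
  constructor
  · intro w hw
    refine LTS.mem_accepts_of_simulation N₁.lts _
      (fun M I => ∃ X ∈ I.1, M = fun p => X (Sum.inl p)) ?_ ?_ ?_ hw
    · rintro _ rfl
      obtain ⟨J, hJ, hmem⟩ := exists_mem_start h
      exact ⟨J, hJ, _, hmem, rfl⟩
    · intro M I a M' hM htr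
      refine exists_mem_step hM htr ?_
      obtain ⟨X, hX, -⟩ := hM
      exact ⟨X, hX, (hdet.2 _ a).exists⟩
    · rintro _ I ⟨X, hX, rfl⟩ hfin
      exact ⟨X, hX, hfin⟩
  · intro w hw
    refine LTS.notMem_language_of_invariant N₂.lts _
      (fun M I => ∃ X ∈ I.1, M ≤ fun p => X (Sum.inr p)) ?_ ?_ ?_ hw
    · rintro _ rfl J hJ
      exact ⟨_, initial_mem_of_mem_start hJ, le_rfl⟩
    · exact fun M I a M' J hM htr hJ =>
        exists_mem_ge_of_mem_step hdet.isPartialDeterministic hM htr hJ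
    · exact fun M I hM hfin => notMem_accept_of_final_le hM hfin

/-! ### Partially deterministic nets -/

/-- The separating automaton with an additional accepting sink `none`, which is entered when no
marking of the current ideal enables the letter in the second net. -/
def completedNFA (N₁ : PetriNet α P₁ T₁) (N₂ : PetriNet α P₂ T₂) :
    NFA α (Option (invariantIdeals N₁ N₂)) where
  step
    | none, _ => {none}
    | some I, a => some '' (separatingNFA N₁ N₂).step I a ∪
        {q | q = none ∧ ∀ X ∈ I.1, ∀ Y, ¬ N₂.lts.Tr (fun p => X (Sum.inr p)) a Y}
  start := some '' (separatingNFA N₁ N₂).start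
  accept := insert none (some '' (separatingNFA N₁ N₂).accept)

theorem tr_of_le {N : PetriNet α P T} {M M' X : P → ℕ} {a : α} (htr : N.lts.Tr M a M')
    (hle : M ≤ X) : ∃ Y, N.lts.Tr X a Y := by
  obtain ⟨t, ht, hta⟩ := htr
  exact ⟨_, t, fires_iff.2 ⟨fun p => (ht.1 p).trans (hle p), rfl⟩, hta⟩

theorem separates_completedNFA [Fintype P₁] [Fintype P₂] [Finite T₁] [Finite T₂]
    (h : ∀ w, w ∈ N₁.language → w ∉ N₂.language) (hdet : N₂.IsPartialDeterministic) :
    Separates (completedNFA N₁ N₂).accepts N₁.language N₂.language := by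
  constructor
  · intro w hw
    refine LTS.mem_accepts_of_simulation N₁.lts _
      -- Vacuous at the sink, which accepts every continuation.
      (fun M q => ∀ I ∈ q, ∃ X ∈ I.1, M = fun p => X (Sum.inl p)) ?_ ?_ ?_ hw
    · rintro _ rfl
      obtain ⟨J, hJ, hmem⟩ := exists_mem_start h
      refine ⟨some J, ⟨J, hJ, rfl⟩, ?_⟩
      rintro _ ⟨⟩
      exact ⟨_, hmem, rfl⟩
    · rintro M (_ | I) a M' hM htr
      · exact ⟨none, rfl, fun I hI => absurd hI (Option.not_mem_none I)⟩
      · by_cases hen : ∃ X ∈ I.1, ∃ Y, N₂.lts.Tr (fun p => X (Sum.inr p)) a Y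
        · obtain ⟨J, hJ, hX⟩ := exists_mem_step (hM I rfl) htr hen
          refine ⟨some J, Or.inl ⟨J, hJ, rfl⟩, ?_⟩
          rintro _ ⟨⟩
          exact hX
        · push Not at hen
          exact ⟨none, Or.inr ⟨rfl, hen⟩, fun I hI => absurd hI (Option.not_mem_none I)⟩
    · rintro M (_ | I) hM hfin
      · exact Or.inl rfl
      · obtain ⟨X, hX, rfl⟩ := hM I rfl
        exact Or.inr ⟨I, ⟨X, hX, hfin⟩, rfl⟩
  · intro w hw
    refine LTS.notMem_language_of_invariant N₂.lts _
      -- Never holds at the sink: if `N₂` can fire a letter, so can every larger marking, in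
      -- particular the dominating one in the ideal, and the sink is not entered.
      (fun M q => ∃ I ∈ q, ∃ X ∈ I.1, M ≤ fun p => X (Sum.inr p)) ?_ ?_ ?_ hw
    · rintro _ rfl _ ⟨J, hJ, rfl⟩
      exact ⟨J, rfl, _, initial_mem_of_mem_start hJ, le_rfl⟩
    · rintro M _ a M' q' ⟨I, ⟨⟩, hM⟩ htr (⟨J, hJ, rfl⟩ | ⟨-, hq⟩)
      · exact ⟨J, rfl, exists_mem_ge_of_mem_step hdet hM htr hJ⟩
      · obtain ⟨X, hX, hle⟩ := hM
        obtain ⟨Y, hY⟩ := tr_of_le htr hle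
        exact absurd hY (hq X hX Y)
    · rintro M _ ⟨I, ⟨⟩, hM⟩ hfin (hq | ⟨_, hI, ⟨⟩⟩)
      · exact Option.some_ne_none I hq
      · exact notMem_accept_of_final_le hM hfin hI

end Product

/-! ### Numerical estimates in terms of the net sizes -/

section Size

variable [Fintype P] [Fintype T] [Fintype P₁] [Fintype T₁] [Fintype P₂] [Fintype T₂]

theorem le_two_pow_of_clog_le {n m s : ℕ} (hnm : n ≤ m) (h : Nat.clog 2 (1 + m) ≤ s) :
    n ≤ 2 ^ s :=
  calc n ≤ 1 + m := by omega
    _ ≤ 2 ^ Nat.clog 2 (1 + m) := Nat.le_pow_clog one_lt_two _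
    _ ≤ 2 ^ s := Nat.pow_le_pow_right two_pos h

theorem card_le_size (N : PetriNet α P T) : Fintype.card P ≤ N.size := by
  have : Fintype.card P ≤ markingSize N.final :=
    Nat.le_mul_of_pos_right _ (by omega)
  unfold size
  omega

theorem final_le_two_pow_size (N : PetriNet α P T) (p : P) : N.final p ≤ 2 ^ N.size := by
  refine le_two_pow_of_clog_le (Finset.le_sup (f := N.final) (Finset.mem_univ p)) ?_
  have hP : 0 < Fintype.card P := Fintype.card_pos_iff.2 ⟨p⟩
  have : 1 + Nat.clog 2 (1 + markingNorm N.final) ≤ markingSize N.final :=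
    Nat.le_mul_of_pos_left _ hP
  unfold size
  unfold markingNorm at this
  omega

theorem pre_le_two_pow_size (N : PetriNet α P T) (t : T) (p : P) : N.pre t p ≤ 2 ^ N.size := by
  have hle : N.pre t p ≤ N.flowNorm :=
    calc N.pre t p ≤ markingNorm (N.pre t) := Finset.le_sup (f := N.pre t) (Finset.mem_univ p)
      _ ≤ max (markingNorm (N.pre t)) (markingNorm (N.post t)) := le_max_left _ _
      _ ≤ N.flowNorm := Finset.le_sup
        (f := fun t => max (markingNorm (N.pre t)) (markingNorm (N.post t))) (Finset.mem_univ t)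
  refine le_two_pow_of_clog_le hle ?_
  have hPT : 0 < Fintype.card P * Fintype.card T :=
    Nat.mul_pos (Fintype.card_pos_iff.2 ⟨p⟩) (Fintype.card_pos_iff.2 ⟨t⟩)
  have := Nat.le_mul_of_pos_left (1 + Nat.clog 2 (1 + N.flowNorm)) hPT
  unfold size
  omega

/-- With exponent `e` for `k` places, the recursion gives `(1 + s + e) * (k + 1)` for the next one.
As `k + 1 ≤ s` and `1 ≤ e`, each place costs at most a factor `(s + 2) ^ 2`. -/
theorem one_add_rackoffBound_le (s k : ℕ) (hk : k ≤ s) :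
    1 + rackoffBound (2 ^ s) k ≤ 2 ^ (s + 2) ^ (2 * k) := by
  induction k with
  | zero => simp [rackoffBound]
  | succ k ih =>
    set b := rackoffBound (2 ^ s) k
    set e := (s + 2) ^ (2 * k) with he
    have ih' : 1 + b ≤ 2 ^ e := ih (by omega)
    have hB : 1 + b ≤ 2 ^ s * (1 + b) := Nat.le_mul_of_pos_left _ (by positivity)
    have hB' : 2 ^ s * (1 + b) ≤ (2 ^ s * (1 + b)) ^ (k + 1) :=
      Nat.le_self_pow (by omega) _
    have h2 : 2 * (2 ^ s * (1 + b)) ^ (k + 1) ≤ (2 * (2 ^ s * (1 + b))) ^ (k + 1) := by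
      rw [mul_pow 2]
      exact Nat.mul_le_mul_right _ (Nat.le_self_pow (by omega) _)
    calc 1 + (b + (2 ^ s * (1 + b)) ^ (k + 1))
        = 1 + b + (2 ^ s * (1 + b)) ^ (k + 1) := by ring
      _ ≤ (2 ^ s * (1 + b)) ^ (k + 1) + (2 ^ s * (1 + b)) ^ (k + 1) :=
        Nat.add_le_add_right (hB.trans hB') _
      _ = 2 * (2 ^ s * (1 + b)) ^ (k + 1) := (two_mul _).symm
      _ ≤ (2 * (2 ^ s * (1 + b))) ^ (k + 1) := h2
      _ ≤ (2 * (2 ^ s * 2 ^ e)) ^ (k + 1) := by gcongr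
      _ = 2 ^ ((1 + s + e) * (k + 1)) := by rw [pow_mul]; congr 1; ring
      _ ≤ 2 ^ (s + 2) ^ (2 * (k + 1)) := by
        refine Nat.pow_le_pow_right two_pos ?_
        have hee : (s + 2) ^ (2 * (k + 1)) = (s + 2) ^ 2 * e := by rw [he]; ring
        have he1 : 1 ≤ e := Nat.one_le_pow _ _ (by omega)
        rw [hee]
        calc (1 + s + e) * (k + 1) ≤ (1 + s + e) * s := by gcongr
          _ ≤ (s + 2) ^ 2 * e := by
            nlinarith [Nat.mul_le_mul_left ((1 + s) * s) he1, Nat.zero_le (s * e)]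

theorem pow_card_add_one_le {s d : ℕ} (hd : d ≤ s) :
    (2 ^ s * (1 + rackoffBound (2 ^ s) d) + 1) ^ d + 1 ≤ 2 ^ 2 ^ (2 * (s + 1) ^ 2 + 1) := by
  set e := (s + 2) ^ (2 * s) with he
  have he1 : 1 ≤ e := Nat.one_le_pow _ _ (by omega)
  have hb : 1 + rackoffBound (2 ^ s) d ≤ 2 ^ e :=
    (one_add_rackoffBound_le s d hd).trans (Nat.pow_le_pow_right two_pos
      (Nat.pow_le_pow_right (by omega) (by omega)))
  have hC : 2 ^ s * (1 + rackoffBound (2 ^ s) d) + 1 ≤ 2 ^ (s + e + 1) :=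
    calc 2 ^ s * (1 + rackoffBound (2 ^ s) d) + 1 ≤ 2 ^ s * 2 ^ e + 2 ^ s * 2 ^ e := by
          have : 1 ≤ 2 ^ s * 2 ^ e := Nat.one_le_iff_ne_zero.2 (by positivity)
          gcongr
      _ = 2 ^ (s + e + 1) := by ring
  have hs : s + 2 ≤ 2 ^ (s + 1) := Nat.lt_two_pow_self
  have hexp : (s + e + 1) * s ≤ 2 ^ (2 * (s + 1) ^ 2) :=
    calc (s + e + 1) * s ≤ (s + 2) ^ 2 * e := by
            nlinarith [Nat.mul_le_mul_left ((1 + s) * s) he1, Nat.zero_le (s * e)]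
      _ = (s + 2) ^ (2 * s + 2) := by rw [he]; ring
      _ ≤ (2 ^ (s + 1)) ^ (2 * s + 2) := Nat.pow_le_pow_left hs _
      _ = 2 ^ (2 * (s + 1) ^ 2) := by rw [← pow_mul]; congr 1; ring
  have hpow : (2 ^ s * (1 + rackoffBound (2 ^ s) d) + 1) ^ d ≤ 2 ^ 2 ^ (2 * (s + 1) ^ 2) :=
    calc _ ≤ (2 ^ (s + e + 1)) ^ d := Nat.pow_le_pow_left hC _
      _ ≤ (2 ^ (s + e + 1)) ^ s := Nat.pow_le_pow_right (by positivity) hd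
      _ = 2 ^ ((s + e + 1) * s) := (pow_mul _ _ _).symm
      _ ≤ _ := Nat.pow_le_pow_right two_pos hexp
  calc _ ≤ 2 ^ 2 ^ (2 * (s + 1) ^ 2) + 2 ^ 2 ^ (2 * (s + 1) ^ 2) :=
        Nat.add_le_add hpow (Nat.one_le_two_pow)
    _ = 2 ^ (2 ^ (2 * (s + 1) ^ 2) + 1) := by ring
    _ ≤ _ := Nat.pow_le_pow_right two_pos (by
        have : 1 ≤ 2 ^ (2 * (s + 1) ^ 2) := Nat.one_le_two_pow
        rw [pow_succ 2 (2 * (s + 1) ^ 2)]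
        omega)

/-- With binary encoding, all entries of `pre` and `final` are at most `2 ^ s`, so Rackoff's bound
applies with `R = 2 ^ s`. The additional `1` leaves room for the sink of `completedNFA`. -/
theorem invariantIdeals_finite_and_ncard_add_one_le (N₁ : PetriNet α P₁ T₁) (N₂ : PetriNet α P₂ T₂) :
    (invariantIdeals N₁ N₂).Finite ∧
      (invariantIdeals N₁ N₂).ncard + 1 ≤ 2 ^ 2 ^ (2 * (N₁.size + N₂.size + 1) ^ 2 + 1) := by
  set s := N₁.size + N₂.size with hs
  have h₁ : 2 ^ N₁.size ≤ 2 ^ s := Nat.pow_le_pow_right two_pos (by omega)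
  have h₂ : 2 ^ N₂.size ≤ 2 ^ s := Nat.pow_le_pow_right two_pos (by omega)
  have hpre : ∀ t p, (N₁.prod N₂).pre t p ≤ 2 ^ s := by
    rintro t (p | p)
    · exact (N₁.pre_le_two_pow_size t.1.1 p).trans h₁
    · exact (N₂.pre_le_two_pow_size t.1.2 p).trans h₂
  have hfinal : ∀ p, (N₁.prod N₂).final p ≤ 2 ^ s := by
    rintro (p | p)
    · exact (N₁.final_le_two_pow_size p).trans h₁
    · exact (N₂.final_le_two_pow_size p).trans h₂
  have hd : Fintype.card (P₁ ⊕ P₂) ≤ s := by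
    rw [Fintype.card_sum]
    exact Nat.add_le_add N₁.card_le_size N₂.card_le_size
  obtain ⟨hfin, hcard⟩ := finite_idealDecomposition_compl
    fun M hM => inf_mem_revReach (N := N₁.prod N₂) hpre hfinal hM
  exact ⟨hfin, (Nat.add_le_add_right hcard 1).trans (pow_card_add_one_le hd)⟩

end Size

end PetriNet

theorem mainTheorem7 :
    ∃ p : Polynomial ℕ,
      ∀ {α P₁ T₁ P₂ T₂ : Type*} [Finite α] [Fintype P₁] [Fintype T₁] [Fintype P₂] [Fintype T₂]
        (N₁ : PetriNet α P₁ T₁) (N₂ : PetriNet α P₂ T₂),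
        (∀ w, w ∈ N₁.language → w ∉ N₂.language) →
        (N₂.IsDeterministic →
          (PetriNet.invariantIdeals N₁ N₂).Finite ∧
          (PetriNet.invariantIdeals N₁ N₂).ncard ≤ 2 ^ 2 ^ p.eval (N₁.size + N₂.size) ∧
          Separates (PetriNet.separatingNFA N₁ N₂).accepts N₁.language N₂.language) ∧
        (N₂.IsPartialDeterministic →
          ∃ m ≤ 2 ^ 2 ^ p.eval (N₁.size + N₂.size), ∃ A : NFA α (Fin m),
            Separates A.accepts N₁.language N₂.language) := by
  refine ⟨2 * (Polynomial.X + 1) ^ 2 + 1, fun {α P₁ T₁ P₂ T₂} _ _ _ _ _ N₁ N₂ h => ?_⟩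
  obtain ⟨hfin, hcard⟩ := PetriNet.invariantIdeals_finite_and_ncard_add_one_le N₁ N₂
  have heval : (2 * (Polynomial.X + 1) ^ 2 + 1 : Polynomial ℕ).eval (N₁.size + N₂.size) =
      2 * (N₁.size + N₂.size + 1) ^ 2 + 1 := by simp
  rw [heval]
  refine ⟨fun hdet => ⟨hfin, (Nat.le_succ _).trans hcard,
    PetriNet.separates_separatingNFA h hdet⟩, fun hdet => ?_⟩
  have := hfin.to_subtype
  refine ⟨Nat.card (Option (PetriNet.invariantIdeals N₁ N₂)), ?_,
    (PetriNet.completedNFA N₁ N₂).reindex (Finite.equivFin _), ?_⟩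
  · rwa [Finite.card_option]
  · rw [NFA.accepts_reindex]
    exact PetriNet.separates_completedNFA h hdet
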